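/- Let $\mathbb F$ be a field. For each $k\in\mathbb N$ let $M_k\in\mathbb F^{m_k\times n_k}$ be a matrix with $m_k\ge n_k$, where $m_k\to\infty$ as $k\to\infty$. All logarithms are to base $2$. An $(s,t)$ *linear data structure* computing a matrix $M\in\mathbb F^{m\times n}$ consists of a linear preprocessing map $P:\mathbb F^n\to\mathbb F^s$ and linear query functions $Q_1,\dots,Q_m:\mathbb F^s\to\mathbb F$, such that each $Q_i$ depends on at most $t$ of the $s$ coordinates and $Q_i(P(x))=(Mx)_i$ for all $x\in\mathbb F^n$ and all $i$. (Real values of $s,t$ are rounded down.) A *linear circuit* computing $M$ is a directed acyclic circuit with $n$ inputs and $m$ designated output nodes (inputs or gates), in which every gate computes a linear combination over $\mathbb F$ of the values on its two incoming wires and whose outputs on every input $x\in\mathbb F^n$ are the entries of $Mx$; its size is the number of gates, and its depth is the length of a longest path from an input to an output. The family $(M_k)$ is *computed by $(s_k,t_k)$ linear data structures* if for all sufficiently large $k$ some $(s_k,t_k)$ linear data structure computes $M_k$; it is *computed by linear circuits of size $O(m)$ and depth $O(\log m)$* if there is a constant $c$ such that for all sufficiently large $k$ some linear circuit of size at most $c\,m_k$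 and depth at most $c\log m_k$ computes $M_k$. **Theorem.** Suppose that there is a constant $\varepsilon>0$ such that at least one of the following holds: 1. for every constant $\delta>0$, the family $(M_k)$ is not computed by $\left(\frac{\delta m_k}{\log\log m_k}+n_k,\; m_k^{\varepsilon}\right)$ linear data structures; 2. for every constant $\delta>0$, the family $(M_k)$ is not computed by $\left(\varepsilon m_k+n_k,\; 2^{(\log m_k)^{1-\delta}}\right)$ linear data structures. Then $(M_k)$ is not computed by linear circuits of size $O(m)$ and depth $O(\log m)$. -/

import Mathlib

open Filter

/-- A (nonadaptive) `(s, t)` linear data structure over `F` for a database of `n` field elements and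
`m` queries. The memory consists of `s` cells; query `i` reads the cells in `probes i`, a set of at
most `t` cells that depends only on `i`; preprocessing and query algorithms are linear. -/
structure LinearDataStructure (F : Type*) [Field F] (n m s t : ℕ) where
  /-- preprocessing: the memory content as a function of the database -/
  preprocess : (Fin n → F) →ₗ[F] (Fin s → F)
  /-- the cells read by each query -/
  probes : Fin m → Finset (Fin s)
  /-- the answer to each query as a function of the memory content -/
  query : Fin m → (Fin s → F) →ₗ[F] F
  card_probes_le : ∀ i, (probes i).card ≤ t
  query_congr : ∀ i (y z : Fin s → F), (∀ j ∈ probes i, y j = z j) → query i y = query i z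

/-- The data structure answers every query `(M x)ᵢ` correctly on every database `x`. -/
def LinearDataStructure.Computes {F : Type*} [Field F] {n m s t : ℕ}
    (D : LinearDataStructure F n m s t) (M : Matrix (Fin m) (Fin n) F) : Prop :=
  ∀ (x : Fin n → F) (i : Fin m), D.query i (D.preprocess x) = M.mulVec x i

/-- `M` can be computed by an `(s, t)` linear data structure. -/
def HasLinearDataStructure {F : Type*} [Field F] {m n : ℕ} (M : Matrix (Fin m) (Fin n) F)
    (s t : ℕ) : Prop :=
  ∃ D : LinearDataStructure F n m s t, D.Computes M

/-- A linear circuit over `F` with `n` inputs and `m` outputs. The gates `0, …, size - 1` are listed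
in a topological order: each of the two wires into gate `g` comes from an input (`Sum.inl`) or from
a gate with a smaller index (`Sum.inr`), and `g` computes the linear combination of the values on
these two wires with the given coefficients. Each output is an input node or a gate. -/
structure LinearCircuit (F : Type*) (n m : ℕ) where
  /-- number of gates -/
  size : ℕ
  /-- origin of the two wires into each gate -/
  left : (g : Fin size) → Fin n ⊕ Fin g.val
  right : (g : Fin size) → Fin n ⊕ Fin g.val
  /-- coefficients of the two wires into each gate -/
  leftCoeff : Fin size → F
  rightCoeff : Fin size → F
  /-- the output nodes -/
  output : Fin m → Fin n ⊕ Fin size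

namespace LinearCircuit

variable {F : Type*} {n m : ℕ}

/-- The value computed at gate `g` on input `x`. -/
def gateValue [Field F] (C : LinearCircuit F n m) (x : Fin n → F) (g : Fin C.size) : F :=
  C.leftCoeff g * (match C.left g with
    | Sum.inl j => x j
    | Sum.inr h => C.gateValue x ⟨h.val, h.isLt.trans g.isLt⟩) +
  C.rightCoeff g * (match C.right g with
    | Sum.inl j => x j
    | Sum.inr h => C.gateValue x ⟨h.val, h.isLt.trans g.isLt⟩)
termination_by g.val
decreasing_by all_goals exact h.isLt

/-- The length of a longest path from an input to gate `g`. -/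
def gateDepth (C : LinearCircuit F n m) (g : Fin C.size) : ℕ :=
  1 + max
    (match C.left g with
      | Sum.inl _ => 0
      | Sum.inr h => C.gateDepth ⟨h.val, h.isLt.trans g.isLt⟩)
    (match C.right g with
      | Sum.inl _ => 0
      | Sum.inr h => C.gateDepth ⟨h.val, h.isLt.trans g.isLt⟩)
termination_by g.val
decreasing_by all_goals exact h.isLt

/-- The value at a node (input or gate). -/
def nodeValue [Field F] (C : LinearCircuit F n m) (x : Fin n → F) : Fin n ⊕ Fin C.size → F :=
  Sum.elim x (C.gateValue x)

/-- The length of a longest path from an input to an output. -/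
def depth (C : LinearCircuit F n m) : ℕ :=
  Finset.univ.sup fun i : Fin m => Sum.elim (fun _ => 0) C.gateDepth (C.output i)

/-- On every input `x` the outputs of the circuit are the entries of `M x`. -/
def Computes [Field F] (C : LinearCircuit F n m) (M : Matrix (Fin m) (Fin n) F) : Prop :=
  ∀ (x : Fin n → F) (i : Fin m), C.nodeValue x (C.output i) = M.mulVec x i

end LinearCircuit

/-- The binary logarithm of a natural number. -/
noncomputable def lg (m : ℕ) : ℝ := Real.logb 2 m

/-- The family `M` of matrices can be computed by `(s k, t k)` linear data structures: for all
sufficiently large `k`, the `k`-th matrix can. The bounds are real, so they are rounded down. -/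
def FamilyHasLinearDataStructures {F : Type*} [Field F] {m n : ℕ → ℕ}
    (M : (k : ℕ) → Matrix (Fin (m k)) (Fin (n k)) F) (s t : ℕ → ℝ) : Prop :=
  ∀ᶠ k in atTop, HasLinearDataStructure (M k) ⌊s k⌋₊ ⌊t k⌋₊

/-- The family `M` can be computed by linear circuits of size `O(m)` and depth `O(log m)`. -/
def FamilyHasLinearSizeLogDepthCircuits {F : Type*} [Field F] {m n : ℕ → ℕ}
    (M : (k : ℕ) → Matrix (Fin (m k)) (Fin (n k)) F) : Prop :=
  ∃ c : ℝ, ∀ᶠ k in atTop, ∃ C : LinearCircuit F (n k) (m k),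
    C.Computes (M k) ∧ (C.size : ℝ) ≤ c * (m k : ℝ) ∧ (C.depth : ℝ) ≤ c * lg (m k)

/-! The theorem is the contrapositive of Valiant's depth reduction. Label every node by its depth, a
number below `2 ^ ℓ` with `2 ^ ℓ` of order `log m`. A wire increases the label; sort the wires by
the leading binary digit in which their end labels differ. Cutting the `j` lightest of these `ℓ`
classes removes at most `2 * size * j / ℓ` wires, and deleting those `j` digits leaves labels below
`2 ^ (ℓ - j)` that still increase along the other wires (`exists_depth_reducing_edges`). As gates
have fan-in two, each output then combines at most `2 ^ 2 ^ (ℓ - j)` inputs and cut wires. Storing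
the inputs and the values on cut wires is thus a linear data structure
(`LinearCircuit.Computes.exists_hasLinearDataStructure`). A large constant `j` refutes the first
hypothesis; `j` a small constant fraction of `ℓ` refutes the second. -/

/-! ### Depth reduction for labelled edges -/

/-- Among the `j`-element subsets of `T` some subset has at most average weight. -/
theorem Finset.exists_subset_card_eq_sum_mul_le {α : Type*} [DecidableEq α] (f : α → ℕ)
    (T : Finset α) (j : ℕ) (hj : j ≤ T.card) :
    ∃ S ⊆ T, S.card = j ∧ (∑ i ∈ S, f i) * T.card ≤ j * ∑ i ∈ T, f i := by
  induction T using Finset.strongInduction with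
  | H T ih =>
    rcases hj.eq_or_lt with rfl | hlt
    · exact ⟨T, subset_rfl, rfl, (mul_comm _ _).le⟩
    -- Discard a heaviest element: all `j` elements chosen from the rest weigh at most `f a` each,
    -- which pays for putting `a` back into the average.
    obtain ⟨a, ha, hmax⟩ := T.exists_max_image f (Finset.card_pos.mp (by omega))
    have hcard : (T.erase a).card + 1 = T.card := Finset.card_erase_add_one ha
    have hsum : ∑ i ∈ T.erase a, f i + f a = ∑ i ∈ T, f i := Finset.sum_erase_add _ _ ha
    obtain ⟨S, hST, hS, hle⟩ := ih _ (Finset.erase_ssubset ha) (by omega)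
    refine ⟨S, hST.trans (Finset.erase_subset _ _), hS, ?_⟩
    have hSa : ∑ i ∈ S, f i ≤ j * f a := by
      rw [← hS, ← smul_eq_mul]
      exact Finset.sum_le_card_nsmul _ _ _ fun i hi => hmax i (Finset.erase_subset _ _ (hST hi))
    rw [← hcard, ← hsum]
    nlinarith

/-- The leading binary digit in which two numbers `a < b` differ. -/
theorem Nat.exists_leading_difference {a b : ℕ} (hab : a < b) :
    ∃ i, a.testBit i = false ∧ b.testBit i = true ∧ ∀ k, i < k → a.testBit k = b.testBit k := by
  have hne : a ^^^ b ≠ 0 := by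
    rw [Ne, Nat.xor_eq_zero_iff]
    exact hab.ne
  obtain ⟨i, hi, hk⟩ := Nat.exists_most_significant_bit hne
  have hagree : ∀ k, i < k → a.testBit k = b.testBit k := by
    intro k hik
    simpa [Nat.testBit_xor] using hk k hik
  rw [Nat.testBit_xor] at hi
  cases ha : a.testBit i <;> cases hb : b.testBit i <;> simp [ha, hb] at hi
  · exact ⟨i, ha, hb, hagree⟩
  · exact absurd (Nat.lt_of_testBit i hb ha fun k hik => (hagree k hik).symm) hab.not_gt

/-- The binary digits of numbers below `2 ^ ℓ` in the positions in `S` can be deleted: two numbers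
whose leading difference is not in `S` stay in order. -/
theorem Nat.exists_digit_deletion (ℓ : ℕ) (S : Finset ℕ) (hS : S ⊆ Finset.range ℓ) :
    ∃ ρ : ℕ → ℕ, (∀ a, ρ a < 2 ^ (ℓ - S.card)) ∧
      ∀ a b i, b < 2 ^ ℓ → a.testBit i = false → b.testBit i = true →
        (∀ k, i < k → a.testBit k = b.testBit k) → i ∉ S → ρ a < ρ b := by
  classical
  -- `A a` is the set of one-digits of `a` that are kept. The colexicographic order compares such
  -- sets like binary numbers, and `ρ a` is the rank of `A a` among all `2 ^ (ℓ - S.card)` of them.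
  let A : ℕ → Finset ℕ := fun a => (Finset.range ℓ \ S).filter fun i => a.testBit i
  let V : Finset (Colex (Finset ℕ)) := (Finset.range ℓ \ S).powerset.image toColex
  have hV : V.card ≤ 2 ^ (ℓ - S.card) := by
    refine Finset.card_image_le.trans_eq ?_
    rw [Finset.card_powerset, Finset.card_sdiff_of_subset hS, Finset.card_range]
  have hA : ∀ a, toColex (A a) ∈ V := fun a =>
    Finset.mem_image_of_mem _ (Finset.mem_powerset.mpr (Finset.filter_subset _ _))
  refine ⟨fun a => (V.filter fun w => w < toColex (A a)).card, fun a => ?_, ?_⟩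
  · refine lt_of_lt_of_le (Finset.card_lt_card ?_) hV
    rw [Finset.filter_ssubset]
    exact ⟨_, hA a, lt_irrefl _⟩
  · intro a b i hb hai hbi hk hiS
    have hiℓ : i < ℓ := by
      by_contra hcon
      have hlow := Nat.testBit_lt_two_pow
        (hb.trans_le (Nat.pow_le_pow_right two_pos (not_lt.mp hcon)))
      simp [hbi] at hlow
    have hlt : toColex (A a) < toColex (A b) := by
      rw [Finset.Colex.toColex_lt_toColex_iff_exists_forall_lt]
      refine ⟨i, by simp [A, hiℓ, hiS, hbi], by simp [A, hai], fun k hka hkb => ?_⟩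
      simp only [A, Finset.mem_filter] at hka hkb
      by_contra hik
      rcases (not_lt.mp hik).eq_or_lt with rfl | hlt
      · simp [hai] at hka
      · exact hkb ⟨hka.1, hk k hlt ▸ hka.2⟩
    refine Finset.card_lt_card (Finset.ssubset_iff_of_subset ?_ |>.mpr ⟨toColex (A a), ?_, ?_⟩)
    · exact Finset.monotone_filter_right _ fun w _ hw => lt_trans hw hlt
    · exact Finset.mem_filter.mpr ⟨hA a, hlt⟩
    · simp

/-- Valiant's depth reduction for graphs: if the edges `T` increase vertex labels below `2 ^ ℓ`,
then after the removal of a fraction of at most `j / ℓ` of the edges the remaining ones increase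
labels below `2 ^ (ℓ - j)`. -/
theorem exists_depth_reducing_edges {E : Type*} (T : Finset E) (tail head : E → ℕ) (ℓ j : ℕ)
    (hj : j ≤ ℓ) (hlt : ∀ e ∈ T, tail e < head e) (hhead : ∀ e ∈ T, head e < 2 ^ ℓ) :
    ∃ X ⊆ T, X.card * ℓ ≤ j * T.card ∧ ∃ ρ : ℕ → ℕ, (∀ a, ρ a < 2 ^ (ℓ - j)) ∧
      ∀ e ∈ T, e ∉ X → ρ (tail e) < ρ (head e) := by
  classical
  choose! c hc₀ hc₁ hc using fun e he => Nat.exists_leading_difference (hlt e he)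
  have hcℓ : ∀ e ∈ T, c e ∈ Finset.range ℓ := by
    intro e he
    rw [Finset.mem_range]
    by_contra hcon
    have hlow := Nat.testBit_lt_two_pow
      ((hhead e he).trans_le (Nat.pow_le_pow_right two_pos (not_lt.mp hcon)))
    simp [hc₁ e he] at hlow
  -- `S` holds `j` digit positions that together are the leading difference of at most a fraction `j
  -- / ℓ` of the edges; these edges form `X`.
  obtain ⟨S, hS, hSj, hle⟩ := Finset.exists_subset_card_eq_sum_mul_le
    (fun i => (T.filter fun e => c e = i).card) (Finset.range ℓ) j (by simpa using hj)
  obtain ⟨ρ, hρ, hmono⟩ := Nat.exists_digit_deletion ℓ S hS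
  refine ⟨T.filter fun e => c e ∈ S, Finset.filter_subset _ _, ?_, ρ, hSj ▸ hρ, ?_⟩
  · rw [Finset.card_range, ← Finset.card_eq_sum_card_fiberwise hcℓ] at hle
    refine le_trans (Nat.mul_le_mul_right _ ?_) hle
    rw [Finset.card_eq_sum_card_fiberwise (s := T.filter fun e => c e ∈ S) (f := c) (t := S)
      (fun e he => (Finset.mem_filter.mp (Finset.mem_coe.mp he)).2)]
    exact Finset.sum_le_sum fun i _ => Finset.card_le_card
      (Finset.filter_subset_filter _ (Finset.filter_subset _ _))
  · intro e he heX
    refine hmono _ _ (c e) (hhead e he) (hc₀ e he) (hc₁ e he) (hc e he) fun hcS => heX ?_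
    exact Finset.mem_filter.mpr ⟨he, hcS⟩

/-! ### Data structures as sparse linear combinations -/

theorem HasLinearDataStructure.of_sparse_combinations {F : Type*} [Field F] {m n s t : ℕ}
    {M : Matrix (Fin m) (Fin n) F} {ι : Type*} [Fintype ι] (hs : Fintype.card ι ≤ s)
    (cell : ι → (Fin n → F) →ₗ[F] F) (c : Fin m → ι →₀ F) (ht : ∀ i, (c i).support.card ≤ t)
    (hc : ∀ x i, Finsupp.linearCombination F (fun u => cell u x) (c i) = M.mulVec x i) :
    HasLinearDataStructure M s t := by
  obtain ⟨e⟩ : Nonempty (ι ↪ Fin s) := Function.Embedding.nonempty_of_card_le (by simpa using hs)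
  let D : LinearDataStructure F n m s t :=
    -- Surplus cells hold zero.
    { preprocess := LinearMap.pi (Function.extend e cell 0)
      probes := fun i => (c i).support.map e
      query := fun i => ∑ u ∈ (c i).support, c i u • LinearMap.proj (e u)
      card_probes_le := fun i => by simpa using ht i
      query_congr := fun i y z hyz => by
        simp only [LinearMap.sum_apply, LinearMap.smul_apply, LinearMap.proj_apply]
        exact Finset.sum_congr rfl fun u hu => by rw [hyz _ (Finset.mem_map_of_mem e hu)] }
  refine ⟨D, fun x i => ?_⟩
  rw [← hc x i, Finsupp.linearCombination_apply, Finsupp.sum]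
  simp [D, e.injective.extend_apply]

theorem HasLinearDataStructure.mono {F : Type*} [Field F] {m n s t s' t' : ℕ}
    {M : Matrix (Fin m) (Fin n) F} (h : HasLinearDataStructure M s t) (hs : s ≤ s') (ht : t ≤ t') :
    HasLinearDataStructure M s' t' := by
  classical
  obtain ⟨D, hD⟩ := h
  let c : Fin m → Fin s →₀ F := fun i =>
    Finsupp.onFinset (D.probes i) (fun u => if u ∈ D.probes i then D.query i (Pi.single u 1) else 0)
      (by simp +contextual)
  refine .of_sparse_combinations (by simpa using hs) (fun u => LinearMap.proj u ∘ₗ D.preprocess) c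
    (fun i => (Finset.card_le_card Finsupp.support_onFinset_subset).trans
      ((D.card_probes_le i).trans ht)) fun x i => ?_
  rw [← hD x i, Finsupp.linearCombination_onFinset]
  -- The query cannot see cells that it does not probe, so the memory may be set to zero there;
  -- linearity then gives the coefficients as values on unit vectors.
  rw [D.query_congr i _ (∑ u ∈ D.probes i, D.preprocess x u • Pi.single u 1)]
  · rw [map_sum]
    exact Finset.sum_congr rfl fun u hu => by simp [hu, mul_comm]
  · intro k hk
    simp [Finset.sum_apply, Pi.single_apply, hk]

/-! ### Depth reduction for linear circuits -/

namespace LinearCircuit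

variable {F : Type*} {n m : ℕ}

/-- The origin of a wire; the Boolean tells the right wire of a gate from the left one. -/
def source (C : LinearCircuit F n m) (e : Fin C.size × Bool) : Fin n ⊕ Fin C.size :=
  Sum.map id (fun h => ⟨h.val, h.isLt.trans e.1.isLt⟩) (if e.2 then C.right e.1 else C.left e.1)

/-- The length of a longest path from an input to a node. -/
def nodeDepth (C : LinearCircuit F n m) : Fin n ⊕ Fin C.size → ℕ :=
  Sum.elim (fun _ => 0) C.gateDepth

theorem nodeDepth_inr (C : LinearCircuit F n m) (g : Fin C.size) :
    C.nodeDepth (Sum.inr g) =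
      1 + max (C.nodeDepth (C.source (g, false))) (C.nodeDepth (C.source (g, true))) := by
  rw [nodeDepth, Sum.elim_inr, gateDepth]
  congr 2
  · rcases h : C.left g <;> simp [source, h]
  · rcases h : C.right g <;> simp [source, h]

theorem nodeDepth_source_lt (C : LinearCircuit F n m) (e : Fin C.size × Bool) :
    C.nodeDepth (C.source e) < C.nodeDepth (Sum.inr e.1) := by
  obtain ⟨g, b⟩ := e
  rw [nodeDepth_inr]
  cases b <;> simp only <;> omega

theorem nodeValue_inr [Field F] (C : LinearCircuit F n m) (x : Fin n → F) (g : Fin C.size) :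
    C.nodeValue x (Sum.inr g) = C.leftCoeff g * C.nodeValue x (C.source (g, false)) +
      C.rightCoeff g * C.nodeValue x (C.source (g, true)) := by
  rw [nodeValue, Sum.elim_inr, gateValue]
  congr 2
  · rcases h : C.left g <;> simp [source, h]
  · rcases h : C.right g <;> simp [source, h]

/-- Makes it legitimate to store the value on a cut wire: preprocessing must be linear. -/
theorem exists_linearMap_eq_nodeValue [Field F] (C : LinearCircuit F n m)
    (v : Fin n ⊕ Fin C.size) :
    ∃ φ : (Fin n → F) →ₗ[F] F, ∀ x, φ x = C.nodeValue x v := by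
  induction hd : C.nodeDepth v using Nat.strong_induction_on generalizing v with
  | _ d ih =>
    subst hd
    rcases v with j | g
    · exact ⟨LinearMap.proj j, fun x => rfl⟩
    · obtain ⟨φ, hφ⟩ := ih _ (C.nodeDepth_source_lt (g, false)) _ rfl
      obtain ⟨ψ, hψ⟩ := ih _ (C.nodeDepth_source_lt (g, true)) _ rfl
      exact ⟨C.leftCoeff g • φ + C.rightCoeff g • ψ, fun x => by simp [nodeValue_inr, hφ, hψ]⟩

/-- If the values on the wires in `X` are known, and the other wires into nodes of depth less than
`d` increase the label `ρ` of the depth, then every node of depth less than `d` depends on few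
inputs and wires in `X`. -/
theorem exists_sparse_combination [Field F] (C : LinearCircuit F n m)
    (X : Finset (Fin C.size × Bool)) (d : ℕ) (ρ : ℕ → ℕ)
    (hρ : ∀ e, C.nodeDepth (Sum.inr e.1) < d → e ∉ X →
      ρ (C.nodeDepth (C.source e)) < ρ (C.nodeDepth (Sum.inr e.1)))
    (v : Fin n ⊕ Fin C.size) (hv : C.nodeDepth v < d) :
    ∃ c : Fin n ⊕ X →₀ F, c.support.card ≤ 2 ^ (ρ (C.nodeDepth v) + 1) ∧
      ∀ x, Finsupp.linearCombination F
        (Sum.elim x fun e : X => C.nodeValue x (C.source e)) c = C.nodeValue x v := by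
  classical
  induction hd : C.nodeDepth v using Nat.strong_induction_on generalizing v with
  | _ k ih =>
    subst hd
    rcases v with j | g
    · refine ⟨Finsupp.single (Sum.inl j) 1, ?_, fun x => by simp [nodeValue]⟩
      exact (Finset.card_le_card Finsupp.support_single_subset).trans Nat.one_le_two_pow
    -- A wire in `X` costs one stored value; any other wire comes from a node of smaller label, so
    -- its bound `2 ^ (ρ + 1)` is at most two to the label of `g`. The two wires together double
    -- this.
    · have hwire : ∀ b, ∃ c : Fin n ⊕ X →₀ F,
          c.support.card ≤ 2 ^ ρ (C.nodeDepth (Sum.inr g)) ∧ ∀ x, Finsupp.linearCombination F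
            (Sum.elim x fun e : X => C.nodeValue x (C.source e)) c =
              C.nodeValue x (C.source (g, b)) := by
        intro b
        by_cases hb : (g, b) ∈ X
        · refine ⟨Finsupp.single (Sum.inr ⟨_, hb⟩) 1, ?_, fun x => by simp⟩
          exact (Finset.card_le_card Finsupp.support_single_subset).trans Nat.one_le_two_pow
        · have hlt := C.nodeDepth_source_lt (g, b)
          obtain ⟨c, hc, hval⟩ := ih _ hlt _ (hlt.trans hv) rfl
          exact ⟨c, hc.trans (Nat.pow_le_pow_right two_pos (hρ (g, b) hv hb)), hval⟩
      obtain ⟨c₀, hc₀, hval₀⟩ := hwire false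
      obtain ⟨c₁, hc₁, hval₁⟩ := hwire true
      refine ⟨C.leftCoeff g • c₀ + C.rightCoeff g • c₁, ?_, fun x => ?_⟩
      · have h₀ := Finset.card_le_card (Finsupp.support_smul (b := C.leftCoeff g) (g := c₀))
        have h₁ := Finset.card_le_card (Finsupp.support_smul (b := C.rightCoeff g) (g := c₁))
        refine (Finset.card_le_card Finsupp.support_add).trans
          ((Finset.card_union_le _ _).trans ?_)
        rw [pow_succ]
        omega
      · rw [map_add, map_smul, map_smul, hval₀, hval₁, nodeValue_inr, smul_eq_mul, smul_eq_mul]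

/-- Valiant's depth reduction: a linear circuit of depth less than `2 ^ ℓ` yields linear data
structures with few cells besides the inputs. -/
theorem Computes.exists_hasLinearDataStructure [Field F] {C : LinearCircuit F n m}
    {M : Matrix (Fin m) (Fin n) F} (hC : C.Computes M) {ℓ j : ℕ} (hd : C.depth < 2 ^ ℓ)
    (hj : j ≤ ℓ) :
    ∃ r, r * ℓ ≤ j * (2 * C.size) ∧ HasLinearDataStructure M (n + r) (2 ^ 2 ^ (ℓ - j)) := by
  classical
  -- `C.depth` bounds only the depth of outputs; deeper gates are irrelevant to them and their wires
  -- are left out.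
  obtain ⟨X, -, hX, ρ, hρ, hmono⟩ := exists_depth_reducing_edges
    (Finset.univ.filter fun e : Fin C.size × Bool => C.nodeDepth (Sum.inr e.1) < 2 ^ ℓ)
    (fun e => C.nodeDepth (C.source e)) (fun e => C.nodeDepth (Sum.inr e.1)) ℓ j hj
    (fun e _ => C.nodeDepth_source_lt e) (fun e he => (Finset.mem_filter.mp he).2)
  refine ⟨X.card, hX.trans (Nat.mul_le_mul_left _ ?_), ?_⟩
  · refine (Finset.card_filter_le _ _).trans_eq ?_
    simp [mul_comm]
  choose φ hφ using C.exists_linearMap_eq_nodeValue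
  have hout : ∀ i, C.nodeDepth (C.output i) < 2 ^ ℓ := fun i =>
    (Finset.le_sup (f := fun i => C.nodeDepth (C.output i)) (Finset.mem_univ i)).trans_lt hd
  choose c hc hval using fun i => C.exists_sparse_combination X (2 ^ ℓ) ρ
    (fun e he heX => hmono e (by simpa using he) heX) (C.output i) (hout i)
  refine .of_sparse_combinations (ι := Fin n ⊕ X) (by simp)
    (Sum.elim LinearMap.proj fun e => φ (C.source e)) c
    (fun i => (hc i).trans (Nat.pow_le_pow_right two_pos (hρ _))) fun x i => ?_
  rw [← hC x i, ← hval i x]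
  congr 2
  ext (u | u) <;> simp [hφ]

end LinearCircuit

/-! ### Choice of parameters -/

/-- Every real number `x ≥ 1` lies between two consecutive powers of two. -/
theorem exists_two_pow_bounds {x : ℝ} (hx : 1 ≤ x) :
    ∃ ℓ : ℕ, x < 2 ^ ℓ ∧ (2 : ℝ) ^ ℓ ≤ 2 * x := by
  obtain ⟨k, hk, hk'⟩ := exists_nat_pow_near hx one_lt_two
  exact ⟨k + 1, hk', by rw [pow_succ]; linarith⟩

/-- The trade-off between space and probes for matrices computed by small shallow circuits. -/
theorem LinearCircuit.Computes.exists_trade_off {F : Type*} [Field F] {m n : ℕ}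
    {M : Matrix (Fin m) (Fin n) F} {C : LinearCircuit F n m} (hC : C.Computes M) {c : ℝ}
    (hc : 1 ≤ c) (hsize : (C.size : ℝ) ≤ c * m) (hdepth : (C.depth : ℝ) ≤ c * lg m)
    (hlg : 1 ≤ lg m) :
    ∃ ℓ : ℕ, Real.logb 2 (lg m) ≤ ℓ ∧ ∀ j ≤ ℓ, ∀ s t : ℝ, j * (2 * (c * m)) ≤ s * ℓ → 0 < ℓ →
      (2 : ℝ) ^ (2 * (c * lg m) / 2 ^ j) ≤ t → HasLinearDataStructure M ⌊s + n⌋₊ ⌊t⌋₊ := by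
  -- The lower bound on `2 ^ ℓ` covers the circuit depth and gives `ℓ ≥ log log m`; the upper bound
  -- limits the number of probes.
  obtain ⟨ℓ, hlt, hle⟩ := exists_two_pow_bounds (one_le_mul_of_one_le_of_one_le hc hlg)
  refine ⟨ℓ, ?_, fun j hj s t hs hℓ ht => ?_⟩
  · rw [Real.logb_le_iff_le_rpow one_lt_two (by linarith), Real.rpow_natCast]
    nlinarith
  obtain ⟨r, hr, hLDS⟩ := hC.exists_hasLinearDataStructure (ℓ := ℓ) (j := j)
    (by exact_mod_cast hdepth.trans_lt hlt) hj
  refine hLDS.mono (Nat.le_floor ?_) (Nat.le_floor ?_)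
  · have hr' : (r : ℝ) * ℓ ≤ j * (2 * C.size) := by exact_mod_cast hr
    have hℓ' : (0 : ℝ) < ℓ := by exact_mod_cast hℓ
    have hj' : (j : ℝ) * (2 * C.size) ≤ j * (2 * (c * m)) := by gcongr
    have hrs : (r : ℝ) ≤ s := le_of_mul_le_mul_right (hr'.trans (hj'.trans hs)) hℓ'
    push_cast
    linarith
  · refine le_trans ?_ ht
    push_cast
    rw [← Real.rpow_natCast]
    refine Real.rpow_le_rpow_of_exponent_le one_le_two ?_
    push_cast
    rw [pow_sub₀ _ two_ne_zero hj, ← div_eq_mul_inv]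
    gcongr

theorem tendsto_lg_comp {m : ℕ → ℕ} (hm : Tendsto m atTop atTop) :
    Tendsto (fun k => lg (m k)) atTop atTop :=
  (Real.tendsto_logb_atTop one_lt_two).comp (tendsto_natCast_atTop_atTop.comp hm)

theorem rpow_lg {m : ℕ} (hm : 1 ≤ lg m) (ε : ℝ) : (2 : ℝ) ^ (ε * lg m) = (m : ℝ) ^ ε := by
  have hpos : (0 : ℝ) < m := by
    rcases Nat.eq_zero_or_pos m with rfl | h
    · norm_num [lg] at hm
    · exact_mod_cast h
  rw [mul_comm, Real.rpow_mul two_pos.le, lg, Real.rpow_logb two_pos (by norm_num) hpos]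

theorem FamilyHasLinearSizeLogDepthCircuits.exists_one_le {F : Type*} [Field F] {m n : ℕ → ℕ}
    (hm : Tendsto m atTop atTop) {M : (k : ℕ) → Matrix (Fin (m k)) (Fin (n k)) F}
    (h : FamilyHasLinearSizeLogDepthCircuits M) (b : ℝ) :
    ∃ c, 1 ≤ c ∧ b ≤ c ∧ ∀ᶠ k in atTop, ∃ C : LinearCircuit F (n k) (m k),
      C.Computes (M k) ∧ (C.size : ℝ) ≤ c * (m k : ℝ) ∧ (C.depth : ℝ) ≤ c * lg (m k) := by
  obtain ⟨c, hc⟩ := h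
  refine ⟨max c (max 1 b), by simp, by simp, ?_⟩
  filter_upwards [hc, (tendsto_lg_comp hm).eventually_ge_atTop 0] with k ⟨C, hC, hs, hd⟩ hlg
  exact ⟨C, hC, hs.trans (by gcongr; exact le_max_left _ _),
    hd.trans (by gcongr; exact le_max_left _ _)⟩

/-- Linear circuits of linear size and logarithmic depth yield linear data structures with
`O(m / log log m)` redundant cells and `m ^ ε` probes. -/
theorem FamilyHasLinearSizeLogDepthCircuits.exists_rpow_probes {F : Type*} [Field F]
    {m n : ℕ → ℕ} (hm : Tendsto m atTop atTop) {M : (k : ℕ) → Matrix (Fin (m k)) (Fin (n k)) F}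
    (h : FamilyHasLinearSizeLogDepthCircuits M) {ε : ℝ} (hε : 0 < ε) :
    ∃ δ : ℝ, 0 < δ ∧ FamilyHasLinearDataStructures M
      (fun k => δ * (m k : ℝ) / Real.logb 2 (lg (m k)) + (n k : ℝ)) (fun k => (m k : ℝ) ^ ε) := by
  obtain ⟨c, hc1, -, hc⟩ := h.exists_one_le hm 1
  -- This `j` makes `2 * c * lg m / 2 ^ j` at most `ε * lg m`.
  obtain ⟨j, hj⟩ := pow_unbounded_of_one_lt (2 * c / ε) (one_lt_two (α := ℝ))
  have hlim := tendsto_lg_comp hm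
  -- The factor `j + 1` in place of `j` keeps `δ` positive even when `j = 0`.
  refine ⟨2 * c * (j + 1), by positivity, ?_⟩
  filter_upwards [hc, hlim.eventually_ge_atTop 1,
    ((Real.tendsto_logb_atTop one_lt_two).comp hlim).eventually_ge_atTop (j + 1)]
    with k ⟨C, hC, hs, hd⟩ hlg hll
  simp only [Function.comp_apply] at hll
  have hll0 : 0 < Real.logb 2 (lg (m k)) := by
    have := Nat.cast_nonneg (α := ℝ) j
    linarith
  obtain ⟨ℓ, hℓ, key⟩ := hC.exists_trade_off hc1 hs hd hlg
  have hjℓ : j + 1 ≤ ℓ := by exact_mod_cast hll.trans hℓ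
  refine key j (by omega) _ _ ?_ (by omega) ?_
  · rw [div_mul_eq_mul_div, le_div_iff₀ hll0]
    have h0 : (0 : ℝ) ≤ 2 * c * m k := by positivity
    calc (j : ℝ) * (2 * (c * m k)) * Real.logb 2 (lg (m k))
        ≤ (j + 1) * (2 * (c * m k)) * ℓ := by gcongr; linarith
      _ = 2 * c * (j + 1) * m k * ℓ := by ring
  · rw [← rpow_lg hlg]
    refine Real.rpow_le_rpow_of_exponent_le one_le_two ?_
    rw [div_lt_iff₀ hε] at hj
    rw [div_le_iff₀ (by positivity)]
    nlinarith

/-- Linear circuits of linear size and logarithmic depth yield linear data structures with `ε m`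
redundant cells and `2 ^ (log m) ^ (1 - δ)` probes. -/
theorem FamilyHasLinearSizeLogDepthCircuits.exists_subpolynomial_probes {F : Type*} [Field F]
    {m n : ℕ → ℕ} (hm : Tendsto m atTop atTop) {M : (k : ℕ) → Matrix (Fin (m k)) (Fin (n k)) F}
    (h : FamilyHasLinearSizeLogDepthCircuits M) {ε : ℝ} (hε : 0 < ε) :
    ∃ δ : ℝ, 0 < δ ∧ FamilyHasLinearDataStructures M
      (fun k => ε * (m k : ℝ) + (n k : ℝ)) (fun k => (2 : ℝ) ^ (lg (m k) ^ (1 - δ))) := by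
  obtain ⟨c, hc1, hcε, hc⟩ := h.exists_one_le hm ε
  have hlim := tendsto_lg_comp hm
  -- With `j` about `ε * ℓ / (2 * c)`, `2 ^ j` is at least half of `lg m ^ (ε / (2 * c))`. Half of
  -- that exponent becomes `δ`; the other half absorbs the constant factor `4 * c`.
  have hδ : 0 < ε / (4 * c) := by positivity
  refine ⟨ε / (4 * c), hδ, ?_⟩
  filter_upwards [hc, hlim.eventually_ge_atTop 1,
    ((Real.tendsto_logb_atTop one_lt_two).comp hlim).eventually_ge_atTop 1,
    ((tendsto_rpow_atTop hδ).comp hlim).eventually_ge_atTop (4 * c)]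
    with k ⟨C, hC, hs, hd⟩ hlg hll hbig
  simp only [Function.comp_apply] at hll hbig
  have hlg0 : 0 < lg (m k) := by linarith
  obtain ⟨ℓ, hℓ, key⟩ := hC.exists_trade_off hc1 hs hd hlg
  have hℓ1 : 1 ≤ ℓ := by exact_mod_cast hll.trans hℓ
  have hj := Nat.floor_le (a := ε * ℓ / (2 * c)) (by positivity)
  have hj' := Nat.lt_floor_add_one (ε * ℓ / (2 * c))
  set j := ⌊ε * ℓ / (2 * c)⌋₊
  rw [le_div_iff₀ (by positivity)] at hj
  -- Here `ε ≤ c` is needed.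
  have hjℓ : j ≤ ℓ := by
    have : (j : ℝ) ≤ ℓ := by
      refine le_of_mul_le_mul_right (hj.trans ?_) (by positivity : 0 < 2 * c)
      have := Nat.cast_nonneg (α := ℝ) ℓ
      nlinarith
    exact_mod_cast this
  refine key j hjℓ _ _ ?_ hℓ1 ?_
  · have := Nat.cast_nonneg (α := ℝ) (m k)
    calc (j : ℝ) * (2 * (c * m k)) = j * (2 * c) * m k := by ring
      _ ≤ ε * ℓ * m k := by gcongr
      _ = ε * m k * ℓ := by ring
  · refine Real.rpow_le_rpow_of_exponent_le one_le_two ?_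
    have hpow : lg (m k) ^ (ε / (4 * c)) * lg (m k) ^ (ε / (4 * c)) ≤ 2 ^ j * 2 := by
      calc lg (m k) ^ (ε / (4 * c)) * lg (m k) ^ (ε / (4 * c))
          = lg (m k) ^ (ε / (2 * c)) := by
            rw [← Real.rpow_add hlg0]
            congr 1
            field_simp
            norm_num
        _ = 2 ^ (Real.logb 2 (lg (m k)) * (ε / (2 * c))) := by
            rw [Real.rpow_mul two_pos.le, Real.rpow_logb two_pos (by norm_num) hlg0]
        _ ≤ 2 ^ ((j : ℝ) + 1) := by
            refine Real.rpow_le_rpow_of_exponent_le one_le_two (le_trans ?_ hj'.le)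
            calc Real.logb 2 (lg (m k)) * (ε / (2 * c)) ≤ ℓ * (ε / (2 * c)) := by gcongr
              _ = ε * ℓ / (2 * c) := by ring
        _ = 2 ^ j * 2 := by rw [Real.rpow_add two_pos, Real.rpow_natCast, Real.rpow_one]
    rw [Real.rpow_sub hlg0, Real.rpow_one, div_le_div_iff₀ (by positivity) (by positivity)]
    have hz : 0 < lg (m k) ^ (ε / (4 * c)) := by positivity
    have h4 : 2 * c * lg (m k) ^ (ε / (4 * c)) ≤ 2 ^ j := by nlinarith
    nlinarith

theorem mainTheorem5 {F : Type*} [Field F] (m n : ℕ → ℕ) (hnm : ∀ k, n k ≤ m k)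
    (hm : Tendsto m atTop atTop) (M : (k : ℕ) → Matrix (Fin (m k)) (Fin (n k)) F)
    (h : ∃ ε : ℝ, 0 < ε ∧
      ((∀ δ : ℝ, 0 < δ → ¬ FamilyHasLinearDataStructures M
          (fun k => δ * (m k : ℝ) / Real.logb 2 (lg (m k)) + (n k : ℝ))
          (fun k => (m k : ℝ) ^ ε)) ∨
       (∀ δ : ℝ, 0 < δ → ¬ FamilyHasLinearDataStructures M
          (fun k => ε * (m k : ℝ) + (n k : ℝ))
          (fun k => (2 : ℝ) ^ (lg (m k) ^ (1 - δ)))))) :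
    ¬ FamilyHasLinearSizeLogDepthCircuits M := by
  intro hM
  obtain ⟨ε, hε, h | h⟩ := h
  · obtain ⟨δ, hδ, hδM⟩ := hM.exists_rpow_probes hm hε
    exact h δ hδ hδM
  · obtain ⟨δ, hδ, hδM⟩ := hM.exists_subpolynomial_probes hm hε
    exact h δ hδ hδM
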